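/- Let $B_\infty=\langle \sigma_i\ (i\ge 1)\mid \sigma_i\sigma_j=\sigma_j\sigma_i \text{ for } |i-j|\ge 2,\ \sigma_i\sigma_j\sigma_i=\sigma_j\sigma_i\sigma_j \text{ for } |i-j|=1\rangle$ be the braid group on infinitely many strands, let $B_n\le B_\infty$ be the subgroup generated by $\sigma_1,\dots,\sigma_{n-1}$, and let $\partial$ be the endomorphism of $B_\infty$ with $\partial(\sigma_i)=\sigma_{i+1}$ for all $i\ge 1$. Put $\delta_n=\sigma_{n-1}\cdots\sigma_2\sigma_1$ for $n\ge 2$ and $\tau_{p,q}=\delta_{p+1}\,\partial(\delta_{p+1})\cdots\partial^{q-1}(\delta_{p+1})$ for $p,q\ge 1$. Write $[u,v]$ for the commutator of $u$ and $v$. Fix an integer $p\ge 1$, and for $a\in B_\infty$ define a binary operation on $B_\infty$ by $x*_a y=\partial^p(x^{-1})\,a\,\partial^p(y)\,x$. A family $(*_i)_{i\in I}$ of binary operations on a set $S$ is a multi-LD-structure if $x*_i(y*_jz)=(x*_iy)*_j(x*_iz)$ for all $x,y,z\in S$ and all $i,j\in I$ (including $i=j$); it is an LD-structure if it consists of one operation,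 and a bi-LD-structure if it consists of two. The triple $(S,*_1,*_2)$ is a mutual left distributive system if $x*_1(y*_2z)=(x*_1y)*_2(x*_1z)$ and $x*_2(y*_1z)=(x*_2y)*_1(x*_2z)$ for all $x,y,z\in S$. (a) Let $a=a'\tau_{p,p}a''$ with $a',a''\in B_p$. Then $*_a$ is an LD-structure on $B_\infty$ if and only if $[a',a'']=1$. (b) Let $I$ be an index set and, for $i\in I$, let $a_i=a_i'\tau_{p,p}a_i''$ with $a_i',a_i''\in B_p$. Then $(*_{a_i})_{i\in I}$ is a multi-LD-structure on $B_\infty$ if and only if $[a_i',a_j']=[a_i',a_j'']=1$ for all $i,j\in I$. (c) Let $a_1=a_1'\tau_{p,p}a_1''$ and $a_2=a_2'\tau_{p,p}^{-1}a_2''$ with $a_1',a_1'',a_2',a_2''\in B_p$. Then $(*_{a_1},*_{a_2})$ is a bi-LD-structure on $B_\infty$ if and only if $[a_1',a_1'']=[a_2',a_2'']=[a_1',a_2'']=[a_2',a_1'']=[a_1',a_2']=1$. (d) With $a_1,a_2$ as in (c), $(B_\infty,*_{a_1},*_{a_2})$ is a mutual left distributive system if and only if $[a_1',a_2'']=[a_2',a_1'']=[a_1',a_2']=1$.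 -/

import Mathlib

/-- The defining relators of the braid group on infinitely many strands. The generator with index
`i : ℕ` is the Artin generator usually written `σ_{i+1}`. -/
def braidRels : Set (FreeGroup ℕ) :=
  {r | ∃ i j : ℕ, (i + 2 ≤ j ∨ j + 2 ≤ i) ∧
      r = FreeGroup.of i * FreeGroup.of j * (FreeGroup.of j * FreeGroup.of i)⁻¹} ∪
  {r | ∃ i j : ℕ, (i + 1 = j ∨ j + 1 = i) ∧
      r = FreeGroup.of i * FreeGroup.of j * FreeGroup.of i *
        (FreeGroup.of j * FreeGroup.of i * FreeGroup.of j)⁻¹}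

/-- The braid group `B_∞` on infinitely many strands. -/
abbrev BraidInf : Type := PresentedGroup braidRels

namespace BraidInf

/-- `sigma i` is the Artin generator `σ_{i+1}` of `B_∞`. -/
def sigma (i : ℕ) : BraidInf := PresentedGroup.of i

theorem sigma_comm {i j : ℕ} (h : i + 2 ≤ j ∨ j + 2 ≤ i) :
    sigma i * sigma j = sigma j * sigma i := by
  rw [← mul_inv_eq_one]
  exact PresentedGroup.one_of_mem (rels := braidRels) (Or.inl ⟨i, j, h, rfl⟩)

theorem sigma_braid {i j : ℕ} (h : i + 1 = j ∨ j + 1 = i) :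
    sigma i * sigma j * sigma i = sigma j * sigma i * sigma j := by
  rw [← mul_inv_eq_one]
  exact PresentedGroup.one_of_mem (rels := braidRels) (Or.inr ⟨i, j, h, rfl⟩)

/-- The shift endomorphism `∂` of `B_∞`, sending each `σ_i` to `σ_{i+1}`. -/
def shift : BraidInf →* BraidInf :=
  PresentedGroup.toGroup (rels := braidRels) (f := fun i => sigma (i + 1)) (by
    rintro r (⟨i, j, h, rfl⟩ | ⟨i, j, h, rfl⟩)
    · simp only [map_mul, map_inv, FreeGroup.lift_apply_of]
      rw [mul_inv_eq_one]
      exact sigma_comm (by omega)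
    · simp only [map_mul, map_inv, FreeGroup.lift_apply_of]
      rw [mul_inv_eq_one]
      exact sigma_braid (by omega))

/-- The braid group `B_n` on `n` strands, as the subgroup of `B_∞` generated by
`σ_1, …, σ_{n-1}`. -/
def strands (n : ℕ) : Subgroup BraidInf :=
  Subgroup.closure {x | ∃ i : ℕ, i + 1 < n ∧ x = sigma i}

/-- The braid `δ_n = σ_{n-1} ⋯ σ_2 σ_1`. -/
def delta (n : ℕ) : BraidInf :=
  ((List.range (n - 1)).reverse.map sigma).prod

/-- The braid `τ_{p,q} = δ_{p+1} ∂(δ_{p+1}) ⋯ ∂^{q-1}(δ_{p+1})`. -/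
def tau (p q : ℕ) : BraidInf :=
  ((List.range q).map fun k => shift^[k] (delta (p + 1))).prod

/-- The operation `x *_a y = ∂^p(x⁻¹) a ∂^p(y) x` (generalized shifted conjugacy). -/
def shiftedConj (p : ℕ) (a x y : BraidInf) : BraidInf :=
  shift^[p] x⁻¹ * a * shift^[p] y * x

end BraidInf

/-- `(S, op)` is an LD-system: `op` is left self-distributive. -/
def IsLDSystem {S : Type*} (op : S → S → S) : Prop :=
  ∀ x y z : S, op x (op y z) = op (op x y) (op x z)

/-- `(S, (op i)_{i ∈ I})` is a multi-LD-system: every operation is left distributive over every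
operation of the family, itself included. -/
def IsMultiLDSystem {I S : Type*} (op : I → S → S → S) : Prop :=
  ∀ (i j : I) (x y z : S), op i x (op j y z) = op j (op i x y) (op i x z)

/-- `(S, op₁, op₂)` is a bi-LD-system: a multi-LD-system with two operations. -/
def IsBiLDSystem {S : Type*} (op₁ op₂ : S → S → S) : Prop :=
  IsMultiLDSystem (![op₁, op₂] : Fin 2 → S → S → S)

/-- `(S, op₁, op₂)` is a mutual left distributive system: each of the two operations is left
distributive over the other one. -/
def IsMutualLDSystem {S : Type*} (op₁ op₂ : S → S → S) : Prop :=
  (∀ x y z : S, op₁ x (op₂ y z) = op₂ (op₁ x y) (op₁ x z)) ∧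
  (∀ x y z : S, op₂ x (op₁ y z) = op₁ (op₂ x y) (op₂ x z))

open scoped commutatorElement

namespace BraidInf

/-! Write `s` for `∂^p`. At `x = y = z = 1`, distributivity of `*_a` over `*_b` reads `s a * a * s b
= b * s a * a`; this suffices for `a, b ∈ B_{2p}`, which commute with the image of `∂^{2p}`
(`shiftedConj_distrib_iff`). Conjugation by `τ = τ_{p,p}` exchanges `B_p` and `s(B_p)`. For `a = a'
τ^{±1} a''` and `b = b' τ^{±1} b''` all factors from `B_p` thus slide to the left, the powers of `τ`
cancel by a braid relation, and `a' b' s(a' b'') = b' a' s(b'' a')` remains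
(`IsBlockSwap.twisted_braid_iff`). Since `B_p` meets the image of `s` trivially, this splits into
`[a', b'] = [a', b''] = 1` (`distrib_iff`), and every part of the theorem is a conjunction of such
cases. Triviality of the intersection comes from deleting strands one at a time
(`eq_one_of_shiftPow_mem`). -/

theorem induction_on {C : BraidInf → Prop} (x : BraidInf) (one : C 1)
    (sigma_mul : ∀ i x, C x → C (sigma i * x)) (inv_mul : ∀ i x, C x → C ((sigma i)⁻¹ * x)) :
    C x := by
  have hx : x ∈ Subgroup.closure (Set.range (PresentedGroup.of (rels := braidRels))) := by
    rw [PresentedGroup.closure_range_of]; trivial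
  induction hx using Subgroup.closure_induction_left with
  | one => exact one
  | mul_left y hy z _ ih => obtain ⟨i, rfl⟩ := hy; exact sigma_mul i z ih
  | inv_mul_cancel y hy z _ ih => obtain ⟨i, rfl⟩ := hy; exact inv_mul i z ih

@[simp] theorem shift_sigma (i : ℕ) : shift (sigma i) = sigma (i + 1) :=
  PresentedGroup.toGroup.of _

/-- The `p`-fold shift as a homomorphism. -/
def shiftPow (p : ℕ) : BraidInf →* BraidInf :=
  MonoidHom.mk' (shift^[p]) fun x y => iterate_map_mul shift p x y

theorem iterate_shift (p : ℕ) : shift^[p] = shiftPow p := rfl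

@[simp] theorem shiftPow_zero (x : BraidInf) : shiftPow 0 x = x := rfl

theorem shiftPow_add (p q : ℕ) (x : BraidInf) :
    shiftPow (p + q) x = shiftPow p (shiftPow q x) :=
  Function.iterate_add_apply shift p q x

theorem shiftPow_succ (p : ℕ) (x : BraidInf) : shiftPow (p + 1) x = shiftPow p (shift x) := rfl

theorem shiftPow_succ' (p : ℕ) (x : BraidInf) : shiftPow (p + 1) x = shift (shiftPow p x) :=
  Function.iterate_succ_apply' shift p x

@[simp] theorem shiftPow_sigma (p i : ℕ) : shiftPow p (sigma i) = sigma (i + p) := by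
  induction p with
  | zero => rfl
  | succ p ih => rw [shiftPow_succ', ih, shift_sigma, add_assoc]

/-! ### Forgetting one strand -/

/-- The action of `σ_i` on a position `k` of a marked strand, together with a braid from which
the marked strand has been deleted. -/
def forgetStep (s : ℕ → BraidInf) (i : ℕ) (v : ℕ × BraidInf) : ℕ × BraidInf :=
  -- A crossing to the right of the marked strand loses one from its index; a crossing with the
  -- marked strand disappears.
  if v.1 < i then (v.1, s (i - 1) * v.2)
  else if v.1 = i then (i + 1, v.2)
  else if v.1 = i + 1 then (i, v.2)
  else (v.1, s i * v.2)

theorem forgetStep_comp {s t : ℕ → BraidInf} (h : ∀ i, s i * t i = 1) (i : ℕ)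
    (v : ℕ × BraidInf) : forgetStep s i (forgetStep t i v) = v := by
  obtain ⟨k, g⟩ := v
  have h' : ∀ i, s i * (t i * g) = g := fun i => by rw [← mul_assoc, h, one_mul]
  unfold forgetStep
  split_ifs <;> grind

/-- `forgetStep` as a permutation. -/
def forgetPerm (i : ℕ) : Equiv.Perm (ℕ × BraidInf) where
  toFun := forgetStep sigma i
  invFun := forgetStep (fun i => (sigma i)⁻¹) i
  left_inv := forgetStep_comp (fun _ => inv_mul_cancel _) i
  right_inv := forgetStep_comp (fun _ => mul_inv_cancel _) i

theorem forgetStep_comm {i j : ℕ} (h : i + 2 ≤ j) (v : ℕ × BraidInf) :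
    forgetStep sigma i (forgetStep sigma j v) = forgetStep sigma j (forgetStep sigma i v) := by
  obtain ⟨k, g⟩ := v
  have h' : ∀ i j, i + 2 ≤ j → sigma i * (sigma j * g) = sigma j * (sigma i * g) := fun i j h => by
    rw [← mul_assoc, sigma_comm (Or.inl h), mul_assoc]
  unfold forgetStep
  rcases lt_trichotomy k i with hk | hk | hk
  · grind
  · grind
  · rcases lt_trichotomy k j with hk' | hk' | hk' <;> grind

theorem forgetStep_braid (i : ℕ) (v : ℕ × BraidInf) :
    forgetStep sigma i (forgetStep sigma (i + 1) (forgetStep sigma i v)) =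
      forgetStep sigma (i + 1) (forgetStep sigma i (forgetStep sigma (i + 1) v)) := by
  obtain ⟨k, g⟩ := v
  have h' : ∀ i, sigma i * (sigma (i + 1) * (sigma i * g)) =
      sigma (i + 1) * (sigma i * (sigma (i + 1) * g)) := fun i => by
    simpa only [mul_assoc] using congrArg (· * g) (sigma_braid (Or.inl (rfl : i + 1 = i + 1)))
  unfold forgetStep
  rcases lt_trichotomy k i with hk | hk | hk
  · obtain ⟨i, rfl⟩ : ∃ j, i = j + 1 := ⟨i - 1, by omega⟩
    have h1 : k < i + 1 + 1 := by omega
    simp [hk, h1, h']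
  · grind
  · rcases Nat.lt_or_ge (i + 2) k with hk' | hk'
    · have h1 : ¬ k < i := by omega
      have h2 : ¬ k < i + 1 := by omega
      have h3 : k ≠ i := by omega
      have h4 : k ≠ i + 1 := by omega
      have h5 : k ≠ i + 1 + 1 := by omega
      simp [h1, h2, h3, h4, h5, h']
    · grind

/-- The action of `B_∞` on positions of a marked strand and braids on the other strands. -/
def forget : BraidInf →* Equiv.Perm (ℕ × BraidInf) :=
  PresentedGroup.toGroup (rels := braidRels) (f := forgetPerm) (by
    rintro r (⟨i, j, h, rfl⟩ | ⟨i, j, h, rfl⟩)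
    · simp only [map_mul, map_inv, FreeGroup.lift_apply_of]
      rw [mul_inv_eq_one]
      rcases h with h | h
      · exact Equiv.ext (forgetStep_comm h)
      · exact Equiv.ext fun v => (forgetStep_comm h v).symm
    · simp only [map_mul, map_inv, FreeGroup.lift_apply_of]
      rw [mul_inv_eq_one]
      rcases h with rfl | rfl
      · exact Equiv.ext (forgetStep_braid i)
      · exact Equiv.ext fun v => (forgetStep_braid j v).symm)

theorem forget_sigma (i : ℕ) (v : ℕ × BraidInf) :
    forget (sigma i) v = forgetStep sigma i v := by
  have : forget (sigma i) = forgetPerm i := PresentedGroup.toGroup.of _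
  rw [this]; rfl

theorem forget_sigma_inv (i : ℕ) (v : ℕ × BraidInf) :
    forget (sigma i)⁻¹ v = forgetStep (fun i => (sigma i)⁻¹) i v := by
  have : forget (sigma i) = forgetPerm i := PresentedGroup.toGroup.of _
  rw [map_inv, this]; rfl

/-- A shifted braid never touches the leftmost strand, so deleting that strand undoes the shift. -/
theorem forget_shift (x : BraidInf) : forget (shift x) (0, 1) = (0, x) := by
  induction x using induction_on with
  | one => simp
  | sigma_mul i x ih =>
    rw [map_mul, map_mul, Equiv.Perm.mul_apply, ih, shift_sigma, forget_sigma]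
    simp [forgetStep]
  | inv_mul i x ih =>
    rw [map_mul, map_mul, Equiv.Perm.mul_apply, ih, map_inv, shift_sigma, forget_sigma_inv]
    simp [forgetStep]

theorem sigma_mem_strands {i n : ℕ} (h : i + 1 < n) : sigma i ∈ strands n :=
  Subgroup.subset_closure ⟨i, h, rfl⟩

theorem strands_mono {m n : ℕ} (h : m ≤ n) : strands m ≤ strands n :=
  Subgroup.closure_mono fun _ ⟨i, hi, hx⟩ => ⟨i, hi.trans_le h, hx⟩

/-- The position bound is carried along for the last case, where `i + 1 < v.1 < n + 1` forces `i + 1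
< n`. -/
theorem forgetStep_mem {s : ℕ → BraidInf} {n i : ℕ} (hs : ∀ i, i + 1 < n → s i ∈ strands n)
    (hi : i + 1 < n + 1) {v : ℕ × BraidInf} (hv : v.1 < n + 1 ∧ v.2 ∈ strands n) :
    (forgetStep s i v).1 < n + 1 ∧ (forgetStep s i v).2 ∈ strands n := by
  obtain ⟨hk, hg⟩ := hv
  unfold forgetStep
  split_ifs
  · exact ⟨hk, mul_mem (hs _ (by omega)) hg⟩
  · exact ⟨hi, hg⟩
  · exact ⟨by simp only; omega, hg⟩
  · exact ⟨hk, mul_mem (hs _ (by omega)) hg⟩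

theorem forget_mem {n : ℕ} {x : BraidInf} (hx : x ∈ strands (n + 1)) :
    (forget x (0, 1)).1 < n + 1 ∧ (forget x (0, 1)).2 ∈ strands n := by
  induction hx using Subgroup.closure_induction_left with
  | one => exact ⟨Nat.succ_pos n, one_mem _⟩
  | mul_left y hy z _ ih =>
    obtain ⟨i, hi, rfl⟩ := hy
    rw [map_mul, Equiv.Perm.mul_apply, forget_sigma]
    exact forgetStep_mem (fun _ => sigma_mem_strands) hi ih
  | inv_mul_cancel y hy z _ ih =>
    obtain ⟨i, hi, rfl⟩ := hy
    rw [map_mul, Equiv.Perm.mul_apply, forget_sigma_inv]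
    exact forgetStep_mem (fun _ h => inv_mem (sigma_mem_strands h)) hi ih

theorem mem_strands_of_shift_mem {n : ℕ} {x : BraidInf} (hx : shift x ∈ strands (n + 1)) :
    x ∈ strands n := by
  simpa [forget_shift] using (forget_mem hx).2

theorem strands_zero : strands 0 = ⊥ := by
  simp [strands]

/-- Each deletion removes one shift and one strand, ending in the trivial group `B_0`. -/
theorem eq_one_of_shiftPow_mem {n : ℕ} {x : BraidInf} (hx : shiftPow n x ∈ strands n) :
    x = 1 := by
  induction n with
  | zero => simpa [strands_zero] using hx
  | succ n ih => exact ih (mem_strands_of_shift_mem (by rwa [← shiftPow_succ']))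

/-! ### Commutation of braids on disjoint sets of strands -/

theorem sigma_comm_shiftPow {i n : ℕ} (h : i + 2 ≤ n) (y : BraidInf) :
    Commute (sigma i) (shiftPow n y) := by
  induction y using induction_on with
  | one => simp
  | sigma_mul j x ih =>
    rw [map_mul, shiftPow_sigma]
    exact Commute.mul_right (sigma_comm (by omega)) ih
  | inv_mul j x ih =>
    rw [map_mul, map_inv, shiftPow_sigma]
    exact Commute.mul_right (Commute.inv_right (sigma_comm (by omega))) ih

theorem commute_shiftPow {n : ℕ} {x : BraidInf} (hx : x ∈ strands n) (y : BraidInf) :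
    Commute x (shiftPow n y) := by
  induction hx using Subgroup.closure_induction with
  | mem x hx => obtain ⟨i, hi, rfl⟩ := hx; exact sigma_comm_shiftPow hi y
  | one => exact Commute.one_left _
  | mul x z _ _ hx hz => exact hx.mul_left hz
  | inv x _ hx => exact hx.inv_left

theorem shiftPow_mem {n : ℕ} {x : BraidInf} (hx : x ∈ strands n) (k : ℕ) :
    shiftPow k x ∈ strands (n + k) := by
  induction hx using Subgroup.closure_induction with
  | mem x hx =>
    obtain ⟨i, hi, rfl⟩ := hx
    rw [shiftPow_sigma]; exact sigma_mem_strands (by omega)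
  | one => simp
  | mul x z _ _ hx hz => rw [map_mul]; exact mul_mem hx hz
  | inv x _ hx => rw [map_inv]; exact inv_mem hx

theorem semiconjBy_of_sigma {n : ℕ} (f g : BraidInf →* BraidInf) (t : BraidInf)
    (h : ∀ i, i + 1 < n → SemiconjBy t (f (sigma i)) (g (sigma i))) {x : BraidInf}
    (hx : x ∈ strands n) : SemiconjBy t (f x) (g x) := by
  induction hx using Subgroup.closure_induction with
  | mem x hx => obtain ⟨i, hi, rfl⟩ := hx; exact h i hi
  | one => simp
  | mul x z _ _ hx hz => rw [map_mul, map_mul]; exact hx.mul_right hz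
  | inv x _ hx => rw [map_inv, map_inv]; exact hx.inv_right

/-! ### The braids `delta` and `tau` -/

theorem delta_one : delta 1 = 1 := rfl

theorem delta_succ (n : ℕ) : delta (n + 2) = sigma n * delta (n + 1) := by
  simp [delta, List.range_succ]

theorem delta_mem (n : ℕ) : delta (n + 1) ∈ strands (n + 1) := by
  induction n with
  | zero => exact one_mem _
  | succ n ih =>
    rw [delta_succ]
    exact mul_mem (sigma_mem_strands (by omega)) (strands_mono (by omega) ih)

theorem sigma_commute_of_mem {i n : ℕ} (h : n ≤ i) {x : BraidInf} (hx : x ∈ strands n) :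
    Commute (sigma i) x := by
  have := (commute_shiftPow hx (sigma (i - n))).symm
  rwa [shiftPow_sigma, Nat.sub_add_cancel h] at this

theorem delta_sigma_succ {p i : ℕ} (h : i + 1 < p) :
    SemiconjBy (delta (p + 1)) (sigma (i + 1)) (sigma i) := by
  induction p with
  | zero => omega
  | succ p ih =>
    rw [delta_succ]
    rcases Nat.lt_or_ge (i + 1) p with hi | hi
    · exact SemiconjBy.mul_left (sigma_comm (by omega)) (ih hi)
    · obtain rfl : p = i + 1 := by omega
      rw [delta_succ]
      have hc : Commute (sigma (i + 1)) (delta (i + 1)) :=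
        sigma_commute_of_mem le_rfl (delta_mem i)
      have hb : sigma (i + 1) * sigma i * sigma (i + 1) = sigma i * sigma (i + 1) * sigma i :=
        sigma_braid (by omega)
      calc sigma (i + 1) * (sigma i * delta (i + 1)) * sigma (i + 1)
          = sigma (i + 1) * sigma i * (delta (i + 1) * sigma (i + 1)) := by group
        _ = sigma (i + 1) * sigma i * sigma (i + 1) * delta (i + 1) := by rw [← hc.eq]; group
        _ = sigma i * (sigma (i + 1) * (sigma i * delta (i + 1))) := by rw [hb]; group

theorem delta_shift {p : ℕ} {x : BraidInf} (hx : x ∈ strands p) :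
    SemiconjBy (delta (p + 1)) (shift x) x :=
  semiconjBy_of_sigma shift (MonoidHom.id _) _
    (fun i hi => by rw [shift_sigma]; exact delta_sigma_succ hi) hx

/-- Two adjacent strands pass `p` others together, so a crossing between them slides along. -/
theorem delta_shift_delta_sigma (p : ℕ) :
    SemiconjBy (delta (p + 1) * shift (delta (p + 1))) (sigma 0) (sigma p) := by
  induction p with
  | zero => simp [delta_one]
  | succ p ih =>
    have hc : Commute (sigma (p + 1)) (delta (p + 1)) := sigma_commute_of_mem le_rfl (delta_mem p)
    have e : delta (p + 2) * shift (delta (p + 2)) =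
        sigma p * sigma (p + 1) * (delta (p + 1) * shift (delta (p + 1))) := by
      rw [delta_succ, map_mul, shift_sigma, mul_assoc, ← mul_assoc (delta _), ← hc.eq]
      group
    rw [e]
    refine SemiconjBy.mul_left ?_ ih
    have hb : sigma p * sigma (p + 1) * sigma p = sigma (p + 1) * sigma p * sigma (p + 1) :=
      sigma_braid (by omega)
    rw [SemiconjBy, hb, mul_assoc]

theorem tau_zero (p : ℕ) : tau p 0 = 1 := rfl

theorem tau_succ (p q : ℕ) : tau p (q + 1) = tau p q * shiftPow q (delta (p + 1)) := by
  simp [tau, List.range_succ, iterate_shift]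

theorem tau_add (p q r : ℕ) : tau p (q + r) = tau p q * shiftPow q (tau p r) := by
  induction r with
  | zero => simp [tau_zero]
  | succ r ih =>
    rw [← add_assoc, tau_succ, ih, tau_succ, map_mul, shiftPow_add, mul_assoc]

theorem tau_mem (p q : ℕ) : tau p q ∈ strands (p + q) := by
  induction q with
  | zero => exact one_mem _
  | succ q ih =>
    rw [tau_succ]
    refine mul_mem (strands_mono (by omega) ih) (strands_mono ?_ (shiftPow_mem (delta_mem p) q))
    omega

theorem tau_shiftPow (p q : ℕ) {x : BraidInf} (hx : x ∈ strands p) :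
    SemiconjBy (tau p q) (shiftPow q x) x := by
  induction q with
  | zero => simp [tau_zero]
  | succ q ih =>
    rw [tau_succ]
    refine SemiconjBy.mul_left ih ?_
    rw [shiftPow_succ]
    exact (delta_shift hx).map (shiftPow q)

theorem tau_sigma (p : ℕ) {q i : ℕ} (h : i + 1 < q) :
    SemiconjBy (tau p q) (sigma i) (sigma (i + p)) := by
  -- Only factors `i` and `i + 1` of the product move the crossing: the later ones commute with
  -- `sigma i`, the earlier ones with `sigma (i + p)`.
  obtain ⟨r, rfl⟩ : ∃ r, q = i + 2 + r := ⟨q - (i + 2), by omega⟩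
  rw [tau_add]
  refine SemiconjBy.mul_left ?_ (sigma_comm_shiftPow le_rfl _).symm
  rw [tau_add]
  refine SemiconjBy.mul_left (y := sigma (i + p)) ?_ ?_
  · exact (sigma_commute_of_mem (by omega) (tau_mem p i)).symm
  · have := (delta_shift_delta_sigma p).map (shiftPow i)
    have e : tau p 2 = delta (p + 1) * shift (delta (p + 1)) := by
      simp [tau, List.range_succ]
    rw [e]
    simpa [add_comm] using this

theorem tau_semiconjBy (p q : ℕ) {x : BraidInf} (hx : x ∈ strands q) :
    SemiconjBy (tau p q) x (shiftPow p x) :=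
  semiconjBy_of_sigma (MonoidHom.id _) (shiftPow p) _
    (fun i hi => by rw [shiftPow_sigma]; exact tau_sigma p hi) hx

/-- The left side is `τ_{p,2p} τ_{p,p}`, and `τ_{p,2p}` shifts elements of `B_{2p}` by `p` as they
pass. -/
theorem tau_braid (p : ℕ) :
    tau p p * shiftPow p (tau p p) * tau p p =
      shiftPow p (tau p p) * tau p p * shiftPow p (tau p p) := by
  rw [← tau_add, (tau_semiconjBy p (p + p) (tau_mem p p)).eq, tau_add, mul_assoc]

/-! ### Distributivity of generalized shifted conjugacy -/

theorem shiftedConj_distrib_iff {p : ℕ} {a b : BraidInf} (ha : a ∈ strands (p + p))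
    (hb : b ∈ strands (p + p)) :
    (∀ x y z, shiftedConj p a x (shiftedConj p b y z) =
        shiftedConj p b (shiftedConj p a x y) (shiftedConj p a x z)) ↔
      shiftPow p a * a * shiftPow p b = b * shiftPow p a * a := by
  simp only [shiftedConj, iterate_shift]
  constructor
  · intro h
    have h1 := h 1 1 1
    simp only [map_inv, map_one, inv_one, one_mul, mul_one] at h1
    rw [mul_assoc, h1]; group
  · intro h x y z
    have ca : ∀ w, Commute a (shiftPow p (shiftPow p w)) := fun w => by
      rw [← shiftPow_add]; exact commute_shiftPow ha w
    have cb : ∀ w, Commute b (shiftPow p (shiftPow p w)) := fun w => by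
      rw [← shiftPow_add]; exact commute_shiftPow hb w
    set s := shiftPow p
    have h' : a * s b = (s a)⁻¹ * b * s a * a := by
      rw [mul_assoc, mul_assoc, ← mul_assoc b, ← h]; group
    simp only [map_mul, map_inv, mul_inv_rev]
    calc (s x)⁻¹ * a * ((s (s y))⁻¹ * s b * s (s z) * s y) * x
        = (s x)⁻¹ * (a * (s (s y))⁻¹) * s b * s (s z) * s y * x := by group
      _ = (s x)⁻¹ * (s (s y))⁻¹ * (a * s b) * s (s z) * s y * x := by
          rw [(ca y).inv_right.eq]; group
      _ = (s x)⁻¹ * (s (s y))⁻¹ * (s a)⁻¹ * b * s a * (a * s (s z)) * s y * x := by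
          rw [h']; group
      -- The inserted pair surrounds `b` on the other side of the law.
      _ = (s x)⁻¹ * (s (s y))⁻¹ * (s a)⁻¹ * (s (s x) * (s (s x))⁻¹ * b) * s a *
            (s (s z) * a) * s y * x := by
          rw [(ca z).eq]; group
      _ = (s x)⁻¹ * (s (s y))⁻¹ * (s a)⁻¹ * (s (s x) * (b * (s (s x))⁻¹)) * s a *
            (s (s z) * a) * s y * x := by
          rw [(cb x).inv_right.eq]; group
      _ = _ := by group

end BraidInf

/-! ### Sliding factors through block swaps -/

/-- Conditions on an element `t` that exchanges the factors of `P` and `s P`. -/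
structure IsBlockSwap {G : Type*} [Group G] (s : G →* G) (P : Subgroup G) (t : G) : Prop where
  left : ∀ x ∈ P, t * x = s x * t
  right : ∀ x ∈ P, t * s x = x * t
  far : ∀ x ∈ P, t * s (s x) = s (s x) * t
  shift : ∀ x ∈ P, s t * x = x * s t

theorem IsBlockSwap.inv {G : Type*} [Group G] {s : G →* G} {P : Subgroup G} {t : G}
    (h : IsBlockSwap s P t) : IsBlockSwap s P t⁻¹ where
  left x hx := (SemiconjBy.inv_symm_left (show SemiconjBy t (s x) x from h.right x hx)).eq
  right x hx := (SemiconjBy.inv_symm_left (show SemiconjBy t x (s x) from h.left x hx)).eq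
  far x hx := (Commute.inv_left (show Commute t (s (s x)) from h.far x hx)).eq
  shift x hx := by
    rw [map_inv]; exact (Commute.inv_left (show Commute (s t) x from h.shift x hx)).eq

/-- Both sides are brought to a normal form: factors from `P`, `s P`, `s (s P)`, then a word in `t,
u`. The tail `s (s (a' * a'))` and, by `hb`, the word agree and cancel; hence `a'` drops out. -/
theorem IsBlockSwap.twisted_braid_iff {G : Type*} [Group G] {s : G →* G} {P : Subgroup G}
    {t u a a' b b' : G} (ht : IsBlockSwap s P t) (hu : IsBlockSwap s P u)
    (hP : ∀ x ∈ P, ∀ y, Commute x (s y)) (hb : s t * t * s u = u * s t * t)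
    (ha : a ∈ P) (ha' : a' ∈ P) (hb1 : b ∈ P) (hb' : b' ∈ P) :
    s (a * t * a') * (a * t * a') * s (b * u * b') =
        (b * u * b') * s (a * t * a') * (a * t * a') ↔
      a * b * s (a * b') = b * a * s (b' * a) := by
  have e1 : ∀ {v}, IsBlockSwap s P v → ∀ x ∈ P, ∀ c, v * (x * c) = s x * (v * c) :=
    fun h x hx c => by rw [← mul_assoc, h.left x hx, mul_assoc]
  have e2 : ∀ {v}, IsBlockSwap s P v → ∀ x ∈ P, ∀ c, v * (s x * c) = x * (v * c) :=
    fun h x hx c => by rw [← mul_assoc, h.right x hx, mul_assoc]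
  have e3 : ∀ {v}, IsBlockSwap s P v → ∀ x ∈ P, ∀ c, v * (s (s x) * c) = s (s x) * (v * c) :=
    fun h x hx c => by rw [← mul_assoc, h.far x hx, mul_assoc]
  have e4 : ∀ {v}, IsBlockSwap s P v → ∀ x ∈ P, ∀ c, s v * (x * c) = x * (s v * c) :=
    fun h x hx c => by rw [← mul_assoc, h.shift x hx, mul_assoc]
  have e5 : ∀ {v}, IsBlockSwap s P v → ∀ x ∈ P, ∀ c, s v * (s x * c) = s (s x) * (s v * c) :=
    fun h x hx c => by rw [← mul_assoc, ← map_mul, h.left x hx, map_mul, mul_assoc]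
  have e6 : ∀ {v}, IsBlockSwap s P v → ∀ x ∈ P, ∀ c, s v * (s (s x) * c) = s x * (s v * c) :=
    fun h x hx c => by rw [← mul_assoc, ← map_mul, h.right x hx, map_mul, mul_assoc]
  have f1 : ∀ y, ∀ x ∈ P, ∀ c, s y * (x * c) = x * (s y * c) :=
    fun y x hx c => by rw [← mul_assoc, ← (hP x hx y).eq, mul_assoc]
  have f2 : ∀ y, ∀ x ∈ P, ∀ c, s (s y) * (s x * c) = s x * (s (s y) * c) :=
    fun y x hx c => by rw [← mul_assoc, ← map_mul, ← (hP x hx y).eq, map_mul, mul_assoc]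
  have L : s (a * t * a') * (a * t * a') * s (b * u * b') =
      a * b * s (a * b') * (s (s (a' * a')) * (s t * t * s u)) := by
    -- The sliding rules need a continuation `c`; a trailing `1` supplies it for the last letter.
    rw [← mul_one (s (a * t * a') * (a * t * a') * s (b * u * b')),
      ← mul_one (s t * t * s u)]
    simp only [map_mul, mul_assoc, ha, ha', hb1, hb', e1 ht, e2 ht, e3 ht, e4 ht, e5 ht, e6 ht,
      e5 hu, f1, f2]
  have R : (b * u * b') * s (a * t * a') * (a * t * a') =
      b * a * s (b' * a) * (s (s (a' * a')) * (s t * t * s u)) := by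
    rw [hb, ← mul_one ((b * u * b') * s (a * t * a') * (a * t * a')), ← mul_one (u * s t * t)]
    simp only [map_mul, mul_assoc, ha, ha', hb', e1 ht, e4 ht, e5 ht, e1 hu,
      e2 hu, e3 hu, f1]
  rw [L, R, mul_left_inj]

/-! ### Reduction to commutators in `B_p` -/

namespace BraidInf

theorem isBlockSwap_tau (p : ℕ) : IsBlockSwap (shiftPow p) (strands p) (tau p p) where
  left _ hx := (tau_semiconjBy p p hx).eq
  right _ hx := (tau_shiftPow p p hx).eq
  far x _ := by rw [← shiftPow_add]; exact (commute_shiftPow (tau_mem p p) x).eq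
  shift _ hx := (commute_shiftPow hx _).eq.symm

/-- Separating the two kinds of factors equates an element of `B_p` with a `p`-fold shift, so both
are trivial. -/
theorem mul_shiftPow_eq_iff {p : ℕ} {a b b' : BraidInf} (ha : a ∈ strands p)
    (hb : b ∈ strands p) :
    a * b * shiftPow p (a * b') = b * a * shiftPow p (b' * a) ↔ ⁅a, b⁆ = 1 ∧ ⁅a, b'⁆ = 1 := by
  rw [commutatorElement_eq_one_iff_mul_comm, commutatorElement_eq_one_iff_mul_comm]
  constructor
  · intro h
    have h1 : shiftPow p ((b' * a) * (a * b')⁻¹) = (b * a)⁻¹ * (a * b) := by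
      rw [map_mul, map_inv, mul_inv_eq_iff_eq_mul, mul_assoc, h, inv_mul_cancel_left]
    have h2 : (b' * a) * (a * b')⁻¹ = 1 := by
      refine eq_one_of_shiftPow_mem (n := p) ?_
      rw [h1]
      exact mul_mem (inv_mem (mul_mem hb ha)) (mul_mem ha hb)
    rw [h2, map_one, eq_comm, inv_mul_eq_one] at h1
    exact ⟨h1.symm, (mul_inv_eq_one.mp h2).symm⟩
  · rintro ⟨h1, h2⟩
    rw [h1, h2]

theorem distrib_iff {p : ℕ} {t u a a' b b' : BraidInf} (ht : t = tau p p ∨ t = (tau p p)⁻¹)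
    (hu : u = tau p p ∨ u = (tau p p)⁻¹) (ha : a ∈ strands p) (ha' : a' ∈ strands p)
    (hb : b ∈ strands p) (hb' : b' ∈ strands p) :
    (∀ x y z, shiftedConj p (a * t * a') x (shiftedConj p (b * u * b') y z) =
        shiftedConj p (b * u * b') (shiftedConj p (a * t * a') x y)
          (shiftedConj p (a * t * a') x z)) ↔ ⁅a, b⁆ = 1 ∧ ⁅a, b'⁆ = 1 := by
  have hle : strands p ≤ strands (p + p) := strands_mono (by omega)
  have hmem : ∀ {v}, (v = tau p p ∨ v = (tau p p)⁻¹) → v ∈ strands (p + p) := by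
    rintro v (rfl | rfl)
    exacts [tau_mem p p, inv_mem (tau_mem p p)]
  have hswap : ∀ {v}, (v = tau p p ∨ v = (tau p p)⁻¹) →
      IsBlockSwap (shiftPow p) (strands p) v := by
    rintro v (rfl | rfl)
    exacts [isBlockSwap_tau p, (isBlockSwap_tau p).inv]
  rw [shiftedConj_distrib_iff (mul_mem (mul_mem (hle ha) (hmem ht)) (hle ha'))
      (mul_mem (mul_mem (hle hb) (hmem hu)) (hle hb')),
    (hswap ht).twisted_braid_iff (hswap hu) (fun x hx y => commute_shiftPow hx y) ?_ ha ha' hb hb',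
    mul_shiftPow_eq_iff ha hb]
  -- All four sign choices of `s t * t * s u = u * s t * t` are rearrangements of the one braid
  -- relation.
  have h := tau_braid p
  rcases ht with rfl | rfl <;> rcases hu with rfl | rfl
  · exact h.symm
  · rw [map_inv, mul_inv_eq_iff_eq_mul, mul_assoc, mul_assoc, eq_inv_mul_iff_mul_eq]
    simpa only [mul_assoc] using h
  · rw [map_inv]
    generalize shiftPow p (tau p p) = v at h ⊢
    rw [eq_mul_inv_iff_mul_eq, mul_assoc, mul_assoc, inv_mul_eq_iff_eq_mul,
      inv_mul_eq_iff_eq_mul]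
    simp only [← mul_assoc]
    rw [h]; group
  · simpa only [map_inv, mul_inv_rev, mul_assoc] using congrArg Inv.inv h.symm

end BraidInf

open BraidInf in
theorem proposition2p1 (p : ℕ) (hp : 1 ≤ p) :
    -- (a)
    (∀ a' a'' : BraidInf, a' ∈ BraidInf.strands p → a'' ∈ BraidInf.strands p →
      (IsLDSystem (BraidInf.shiftedConj p (a' * BraidInf.tau p p * a'')) ↔ ⁅a', a''⁆ = 1)) ∧
    -- (b)
    (∀ (I : Type*) (a' a'' : I → BraidInf),
      (∀ i, a' i ∈ BraidInf.strands p) → (∀ i, a'' i ∈ BraidInf.strands p) →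
      (IsMultiLDSystem
          (fun i : I => BraidInf.shiftedConj p (a' i * BraidInf.tau p p * a'' i)) ↔
        ∀ i j : I, ⁅a' i, a' j⁆ = 1 ∧ ⁅a' i, a'' j⁆ = 1)) ∧
    -- (c)
    (∀ a₁' a₁'' a₂' a₂'' : BraidInf,
      a₁' ∈ BraidInf.strands p → a₁'' ∈ BraidInf.strands p →
      a₂' ∈ BraidInf.strands p → a₂'' ∈ BraidInf.strands p →
      (IsBiLDSystem (BraidInf.shiftedConj p (a₁' * BraidInf.tau p p * a₁''))
          (BraidInf.shiftedConj p (a₂' * (BraidInf.tau p p)⁻¹ * a₂'')) ↔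
        ⁅a₁', a₁''⁆ = 1 ∧ ⁅a₂', a₂''⁆ = 1 ∧ ⁅a₁', a₂''⁆ = 1 ∧ ⁅a₂', a₁''⁆ = 1 ∧
          ⁅a₁', a₂'⁆ = 1)) ∧
    -- (d)
    (∀ a₁' a₁'' a₂' a₂'' : BraidInf,
      a₁' ∈ BraidInf.strands p → a₁'' ∈ BraidInf.strands p →
      a₂' ∈ BraidInf.strands p → a₂'' ∈ BraidInf.strands p →
      (IsMutualLDSystem (BraidInf.shiftedConj p (a₁' * BraidInf.tau p p * a₁''))
          (BraidInf.shiftedConj p (a₂' * (BraidInf.tau p p)⁻¹ * a₂'')) ↔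
        ⁅a₁', a₂''⁆ = 1 ∧ ⁅a₂', a₁''⁆ = 1 ∧ ⁅a₁', a₂'⁆ = 1)) := by
  have hsymm : ∀ x y : BraidInf, ⁅x, y⁆ = 1 ↔ ⁅y, x⁆ = 1 := fun x y => by
    rw [commutatorElement_eq_one_iff_mul_comm, commutatorElement_eq_one_iff_mul_comm, eq_comm]
  refine ⟨fun a' a'' h' h'' => ?_, fun I a' a'' h' h'' => ?_,
    fun a₁' a₁'' a₂' a₂'' h₁' h₁'' h₂' h₂'' => ?_,
    fun a₁' a₁'' a₂' a₂'' h₁' h₁'' h₂' h₂'' => ?_⟩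
  · rw [IsLDSystem, distrib_iff (Or.inl rfl) (Or.inl rfl) h' h'' h' h'']
    simp
  · exact forall₂_congr fun i j =>
      distrib_iff (Or.inl rfl) (Or.inl rfl) (h' i) (h'' i) (h' j) (h'' j)
  · have h11 := distrib_iff (Or.inl rfl) (Or.inl rfl) h₁' h₁'' h₁' h₁''
    have h12 := distrib_iff (Or.inl rfl) (Or.inr rfl) h₁' h₁'' h₂' h₂''
    have h21 := distrib_iff (Or.inr rfl) (Or.inl rfl) h₂' h₂'' h₁' h₁''
    have h22 := distrib_iff (Or.inr rfl) (Or.inr rfl) h₂' h₂'' h₂' h₂''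
    simp only [IsBiLDSystem, IsMultiLDSystem, Fin.forall_fin_two, Matrix.cons_val_zero,
      Matrix.cons_val_one, h11, h12, h21, h22, commutatorElement_self, true_and, hsymm a₂' a₁']
    tauto
  · rw [IsMutualLDSystem, distrib_iff (Or.inl rfl) (Or.inr rfl) h₁' h₁'' h₂' h₂'',
      distrib_iff (Or.inr rfl) (Or.inl rfl) h₂' h₂'' h₁' h₁'', hsymm a₂' a₁']
    tauto
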